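/- Let $\mathbb T\subset\mathbb C$ be the unit circle with the metric $d(z,w)=|z-w|$. A Denjoy counterexample is an orientation-preserving homeomorphism $f:\mathbb T\to\mathbb T$ whose rotation number $\rho$ is irrational and which is not topologically conjugate to the rigid rotation $R_\rho(z)=e^{2\pi i\rho}z$. Let $f$ be a Denjoy counterexample and let $\Lambda\subset\mathbb T$ be its minimal Cantor set, that is, $\Lambda$ is a Cantor set (nonempty, perfect, totally disconnected) with $f(\Lambda)\subset\Lambda$ such that $\overline{\{f^n x: n\ge 0\}}=\Lambda$ for every $x\in\Lambda$. Then for every strictly increasing sequence $\mathbf a=(a_n)_{n\ge1}$ of natural numbers whose set of terms has positive lower density, $$\liminf_{N\to\infty}\frac{\#(\{a_n : n\ge 1\}\cap[1,N])}{N}>0,$$ the map $f|_\Lambda:\Lambda\to\Lambda$ is $\mathbf a$-mean Lyapunov stable: for every $\epsilon>0$ there is a $\delta>0$ such that for all $x,y\in\Lambda$ with $d(x,y)<\delta$ there is a set $E\subset\mathbb N$ (which may depend on $x,y$) with $$\limsup_{N\to\infty}\frac{\#\{1\le n\le N : a_n\in E\}}{N}<\epsilon$$ and $d(f^{a_n}x,f^{a_n}y)<\epsilon$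 for all $n\ge 1$ with $a_n\notin E$. Moreover, $f|_\Lambda$ is not equicontinuous: it is not true that for every $\epsilon>0$ there is a $\delta>0$ such that $d(f^nx,f^ny)<\epsilon$ for all $n\in\mathbb N$ and all $x,y\in\Lambda$ with $d(x,y)<\delta$. -/

import Mathlib

open Set Filter Topology

noncomputable section

/-- The lower density `liminf_N #(E ∩ [1, N]) / N` of a set `E` of natural numbers. -/
def lowerDensity (E : Set ℕ) : ℝ :=
  liminf (fun N : ℕ => ((E ∩ Icc 1 N).ncard : ℝ) / N) atTop

/-- The `a`-upper density `limsup_N #{1 ≤ n ≤ N | a n ∈ E} / N` of `E`; the terms of the sequence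
are `a 1, a 2, …`, and they are counted with multiplicity (the value `a 0` is never used). -/
def upperDensityAlong (a : ℕ → ℕ) (E : Set ℕ) : ℝ :=
  limsup (fun N : ℕ => ({n : ℕ | n ∈ Icc 1 N ∧ a n ∈ E}.ncard : ℝ) / N) atTop

/-- `T` is mean Lyapunov stable along the sequence `a 1, a 2, …`: for every `ε > 0` there is a
`δ > 0` such that any two points at distance less than `δ` stay at distance less than `ε` at all
times `a n`, apart from times in an exceptional set (depending on the two points) whose
`a`-upper density is less than `ε`. -/
def IsMeanLyapunovStableAlong {X : Type*} [MetricSpace X] (a : ℕ → ℕ) (T : X → X) : Prop :=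
  ∀ ε : ℝ, 0 < ε → ∃ δ : ℝ, 0 < δ ∧ ∀ x y : X, dist x y < δ →
    ∃ E : Set ℕ, upperDensityAlong a E < ε ∧
      ∀ n : ℕ, 1 ≤ n → a n ∉ E → dist (T^[a n] x) (T^[a n] y) < ε

/-- `F` is a lift of the circle map `f` under the covering `x ↦ e^{2π i x}`. A homeomorphism of
the circle preserves orientation exactly when it has a lift that is a nondecreasing map of the
line commuting with `x ↦ x + 1`. -/
def IsLiftOf (F : CircleDeg1Lift) (f : Circle → Circle) : Prop :=
  ∀ x : ℝ, Circle.exp (2 * Real.pi * F x) = f (Circle.exp (2 * Real.pi * x))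

/-- The rigid rotation `z ↦ e^{2π i ρ} z` of the unit circle. -/
def rigidRotation (ρ : ℝ) (z : Circle) : Circle :=
  Circle.exp (2 * Real.pi * ρ) * z

/-- A Denjoy counterexample: an orientation-preserving circle homeomorphism whose rotation number
`ρ` (the translation number of a lift, modulo one) is irrational, and which is not topologically
conjugate to the rigid rotation by `ρ`. -/
def IsDenjoyCounterexample (f : Circle ≃ₜ Circle) : Prop :=
  ∃ F : CircleDeg1Lift, IsLiftOf F f ∧ Irrational F.translationNumber ∧
    ¬ ∃ h : Circle ≃ₜ Circle, ∀ z : Circle, h (f z) = rigidRotation F.translationNumber (h z)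

/-- `Λ` is a Cantor set in the circle (nonempty, perfect, totally disconnected; compactness is
automatic since perfect sets are closed) that `f` maps into itself, and `f : Λ → Λ` is minimal,
that is, the forward orbit of each point of `Λ` has closure `Λ`. -/
structure IsMinimalCantorSet (f : Circle → Circle) (Λ : Set Circle) : Prop where
  nonempty : Λ.Nonempty
  perfect : Perfect Λ
  totallyDisconnected : IsTotallyDisconnected Λ
  mapsTo : MapsTo f Λ Λ
  minimal : ∀ x ∈ Λ, closure (range fun n : ℕ => f^[n] x) = Λ

end

/-! An irrational rotation number excludes periodic points, so by compactness `f, …, f^(M-1)` move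
every point by at least some `c > 0`. Fix a finite set `P` meeting every connected set that contains
two points `ε` apart. Join nearby `x, y` by an arc `C` of diameter below `c`. When `f^n x` and `f^n
y` are `ε` apart, `f^n C` meets `P`; the same point cannot recur within `M` steps, as its pullbacks
would be two points of `C` with one moved to the other in fewer than `M` steps. Bad times thus have
density at most `|P| / M`, and positive lower density of the sequence costs only a constant factor
(`exists_ncard_dist_iterate_le`, `upperDensityAlong_lt_of_ncard_le`).

Equicontinuity fails on the endpoints of a gap of `Λ`: the gap is wandering, so some preimages of
its endpoints are arbitrarily close, yet iterating `f` forward restores their original distance. -/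

/-! ### Counting and densities -/

/-- Cut time into blocks of length `M`: each label occurs at most once per block. -/
theorem ncard_inter_Iic_le_of_separated {α : Type*} (E : Set ℕ) (P : Finset α) (φ : ℕ → α)
    {M : ℕ} (hM : 0 < M) (hφ : ∀ n ∈ E, φ n ∈ P)
    (hsep : ∀ n ∈ E, ∀ m ∈ E, n < m → φ n = φ m → n + M ≤ m) (N : ℕ) :
    (E ∩ Iic N).ncard ≤ P.card * (N / M + 1) := by
  classical
  have hcard : (P ×ˢ Finset.range (N / M + 1)).card = P.card * (N / M + 1) := by simp
  rw [← hcard, ← Set.ncard_coe_finset]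
  refine Set.ncard_le_ncard_of_injOn (fun n => (φ n, n / M)) ?_ ?_ (Finset.finite_toSet _)
  · rintro n ⟨hn, hnN⟩
    simp only [Finset.coe_product, Set.mem_prod, Finset.mem_coe, Finset.mem_range]
    exact ⟨hφ n hn, Nat.lt_succ_of_le (Nat.div_le_div_right hnN)⟩
  · have key : ∀ n ∈ E, ∀ m ∈ E, n < m → φ n = φ m → n / M ≠ m / M := by
      intro n hn m hm hlt h heq
      have h1 := hsep n hn m hm hlt h
      have h2 : n / M + 1 ≤ m / M := by
        rw [← Nat.add_div_right n hM]
        exact Nat.div_le_div_right h1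
      omega
    rintro n ⟨hn, -⟩ m ⟨hm, -⟩ h
    simp only [Prod.mk.injEq] at h
    rcases lt_trichotomy n m with hlt | rfl | hlt
    · exact absurd h.2 (key n hn m hm hlt h.1)
    · rfl
    · exact absurd h.2.symm (key m hm n hn hlt h.1.symm)

/-- The shift by one allows for `a 1 = 0`. -/
theorem le_add_one_of_strictMonoOn {a : ℕ → ℕ} (ha : StrictMonoOn a (Ici 1)) {n : ℕ}
    (hn : 1 ≤ n) : n ≤ a n + 1 := by
  induction n, hn using Nat.le_induction with
  | base => omega
  | succ n hn ih =>
    have := ha (mem_Ici.2 hn) (mem_Ici.2 (by omega : 1 ≤ n + 1)) (Nat.lt_succ_self n)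
    omega

/-- Evaluate the density at `N = a n`: at most `n` terms lie in `[1, a n]`. -/
theorem exists_mul_le_of_lowerDensity_pos {a : ℕ → ℕ} (ha : StrictMonoOn a (Ici 1))
    (hd : 0 < lowerDensity (a '' Ici 1)) :
    ∃ c : ℝ, 0 < c ∧ ∀ᶠ n : ℕ in atTop, c * a n ≤ n := by
  obtain ⟨c, hc0, hc⟩ := exists_between hd
  refine ⟨c, hc0, ?_⟩
  have h1 := eventually_lt_of_lt_liminf hc (isBoundedUnder_of ⟨0, fun N => by positivity⟩)
  have hat : Tendsto a atTop atTop := by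
    refine tendsto_atTop_mono' atTop ?_ (tendsto_sub_atTop_nat 1)
    filter_upwards [eventually_ge_atTop 1] with n hn
    have := le_add_one_of_strictMonoOn ha hn
    omega
  filter_upwards [hat.eventually h1, hat.eventually (eventually_ge_atTop 1),
    eventually_ge_atTop 1] with n hn hpos hn1
  have hpos' : (0 : ℝ) < a n := by exact_mod_cast hpos
  rw [lt_div_iff₀ hpos'] at hn
  refine hn.le.trans ?_
  have hsub : a '' Ici 1 ∩ Icc 1 (a n) ⊆ a '' Icc 1 n := by
    rintro _ ⟨⟨i, hi, rfl⟩, -, hin⟩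
    exact ⟨i, ⟨hi, (ha.le_iff_le hi hn1).1 hin⟩, rfl⟩
  have h2 : (a '' Ici 1 ∩ Icc 1 (a n)).ncard ≤ n := by
    refine (Set.ncard_le_ncard hsub ((finite_Icc 1 n).image a)).trans ?_
    refine (Set.ncard_image_le (finite_Icc 1 n)).trans ?_
    simp [Set.ncard_eq_toFinset_card']
  exact_mod_cast h2

theorem upperDensityAlong_lt_of_ncard_le {a : ℕ → ℕ} (ha : StrictMonoOn a (Ici 1)) {c ε : ℝ}
    (hε : 0 < ε) (hac : ∀ᶠ n : ℕ in atTop, c * a n ≤ n) {E : Set ℕ} {q M : ℕ}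
    (hM : 0 < M) (hqM : 4 * q ≤ ε * (c * M))
    (hE : ∀ N, (E ∩ Iic N).ncard ≤ q * (N / M + 1)) :
    upperDensityAlong a E < ε := by
  refine lt_of_le_of_lt (b := ε / 2) ?_ (by linarith)
  refine limsup_le_of_le (isCoboundedUnder_le_of_le atTop (x := 0) fun N => by positivity) ?_
  have hq : ∀ᶠ n : ℕ in atTop, 4 * (q : ℝ) / ε ≤ n :=
    tendsto_natCast_atTop_atTop.eventually_ge_atTop _
  filter_upwards [hac, hq, eventually_ge_atTop 1] with n hn hqn hn1
  have hn0 : (0 : ℝ) < n := by exact_mod_cast hn1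
  have hM0 : (0 : ℝ) < M := by exact_mod_cast hM
  rw [div_le_iff₀ hn0]
  have h1 : {i : ℕ | i ∈ Icc 1 n ∧ a i ∈ E}.ncard ≤ (E ∩ Iic (a n)).ncard := by
    refine Set.ncard_le_ncard_of_injOn a ?_ ?_ ((finite_Iic _).inter_of_right E)
    · rintro i ⟨hi, hiE⟩
      exact ⟨hiE, (ha.le_iff_le hi.1 hn1).2 hi.2⟩
    · rintro i ⟨hi, -⟩ j ⟨hj, -⟩ h
      exact ha.injOn hi.1 hj.1 h
  -- Both summands on the right will be at most `ε / 4 * n`, the first by `hqM`, the second for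
  -- large `n`.
  have h2 : ({i : ℕ | i ∈ Icc 1 n ∧ a i ∈ E}.ncard : ℝ) ≤ q * ((a n : ℝ) / M + 1) := by
    calc ({i : ℕ | i ∈ Icc 1 n ∧ a i ∈ E}.ncard : ℝ) ≤ ((q * (a n / M + 1) : ℕ) : ℝ) := by
          exact_mod_cast h1.trans (hE _)
      _ ≤ q * ((a n : ℝ) / M + 1) := by
          push_cast
          gcongr
          exact Nat.cast_div_le
  have h3 : (q : ℝ) * (a n / M) ≤ ε / 4 * n := by
    have : (q : ℝ) * (a n / M) = q * a n / M := by ring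
    rw [this, div_le_iff₀ hM0]
    have h4 : (4 * q : ℝ) * a n ≤ ε * (c * M) * a n := by gcongr
    have h5 : ε * M * (c * a n) ≤ ε * M * n := by gcongr
    nlinarith
  have h6 : (q : ℝ) ≤ ε / 4 * n := by
    rw [div_le_iff₀ hε] at hqn
    linarith
  linarith

/-! ### Connected subsets of the circle -/

theorem Circle.finite_setOf_re_eq (v : ℝ) : {z : Circle | (z : ℂ).re = v}.Finite := by
  refine Set.Finite.of_finite_image (f := fun z : Circle => (z : ℂ).im) ?_ ?_
  · refine (Set.toFinite {√(1 - v ^ 2), -√(1 - v ^ 2)}).subset ?_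
    rintro _ ⟨z, rfl, rfl⟩
    have h := z.normSq_coe
    rw [Complex.normSq_apply] at h
    rw [mem_insert_iff, mem_singleton_iff, ← sq_eq_sq_iff_eq_or_eq_neg, Real.sq_sqrt] <;>
      nlinarith [sq_nonneg (z : ℂ).im]
  · intro z hz w hw h
    exact Circle.ext (Complex.ext (hz.trans hw.symm) h)

theorem Circle.finite_setOf_im_eq (v : ℝ) : {z : Circle | (z : ℂ).im = v}.Finite := by
  refine Set.Finite.of_finite_image (f := fun z : Circle => (z : ℂ).re) ?_ ?_
  · refine (Set.toFinite {√(1 - v ^ 2), -√(1 - v ^ 2)}).subset ?_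
    rintro _ ⟨z, rfl, rfl⟩
    have h := z.normSq_coe
    rw [Complex.normSq_apply] at h
    rw [mem_insert_iff, mem_singleton_iff, ← sq_eq_sq_iff_eq_or_eq_neg, Real.sq_sqrt] <;>
      nlinarith [sq_nonneg (z : ℂ).re]
  · intro z hz w hw h
    exact Circle.ext (Complex.ext h (hz.trans hw.symm))

theorem IsPreconnected.exists_eq_mul_of_le_sub {X : Type*} [TopologicalSpace X] {C : Set X}
    (hC : IsPreconnected C) {u : X → ℝ} (hu : Continuous u) (hu1 : ∀ z, |u z| ≤ 1) {h : ℝ}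
    (hh : 0 < h) {x y : X} (hx : x ∈ C) (hy : y ∈ C) (hxy : h ≤ |u x - u y|) :
    ∃ j ∈ Icc (-⌈1 / h⌉) ⌈1 / h⌉, ∃ z ∈ C, u z = h * j := by
  wlog hle : u x ≤ u y generalizing x y
  · exact this hy hx (by rwa [abs_sub_comm]) (le_of_not_ge hle)
  rw [abs_of_nonpos (by linarith)] at hxy
  have h1 := Int.le_ceil (u x / h)
  -- The least multiple of `h` above `u x` is still at most `u x + h ≤ u y`.
  have h2 := Int.ceil_lt_add_one (u x / h)
  rw [div_le_iff₀ hh] at h1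
  have h2' : (⌈u x / h⌉ : ℝ) * h ≤ u x + h := by
    have := mul_lt_mul_of_pos_right h2 hh
    rw [add_mul, div_mul_cancel₀ _ hh.ne'] at this
    linarith
  obtain ⟨z, hz, hzu⟩ := hC.intermediate_value hx hy hu.continuousOn
    (⟨by linarith, by linarith⟩ : h * (⌈u x / h⌉ : ℝ) ∈ Icc (u x) (u y))
  have hb := abs_le.1 (hu1 x)
  refine ⟨⌈u x / h⌉, ⟨?_, ?_⟩, z, hz, hzu⟩
  · rw [neg_le, ← Int.floor_neg]
    refine (Int.floor_le_ceil _).trans (Int.ceil_le_ceil ?_)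
    rw [← neg_div]
    gcongr
    linarith
  · apply Int.ceil_le_ceil
    gcongr
    linarith

/-- Take the points with a coordinate in `(ε / 2) ℤ`: between points `ε` apart some coordinate
varies by `ε / 2`, so it hits the grid. -/
theorem Circle.exists_finset_inter_preconnected {ε : ℝ} (hε : 0 < ε) :
    ∃ P : Finset Circle, ∀ C : Set Circle, IsPreconnected C → ∀ x ∈ C, ∀ y ∈ C,
      ε ≤ dist x y → ∃ p ∈ P, p ∈ C := by
  set K := ⌈1 / (ε / 2)⌉
  have hfin : (⋃ j ∈ Icc (-K) K, ({z : Circle | (z : ℂ).re = ε / 2 * j} ∪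
      {z : Circle | (z : ℂ).im = ε / 2 * j})).Finite :=
    (finite_Icc _ _).biUnion fun j _ =>
      (Circle.finite_setOf_re_eq _).union (Circle.finite_setOf_im_eq _)
  refine ⟨hfin.toFinset, fun C hC x hx y hy hxy => ?_⟩
  have hd : dist x y ≤ |(x : ℂ).re - (y : ℂ).re| + |(x : ℂ).im - (y : ℂ).im| := by
    have := Complex.norm_le_abs_re_add_abs_im ((x : ℂ) - y)
    rwa [Complex.sub_re, Complex.sub_im, ← Complex.dist_eq] at this
  have hre : ∀ z : Circle, |(z : ℂ).re| ≤ 1 := fun z =>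
    (Complex.abs_re_le_norm _).trans z.norm_coe.le
  have him : ∀ z : Circle, |(z : ℂ).im| ≤ 1 := fun z =>
    (Complex.abs_im_le_norm _).trans z.norm_coe.le
  have hcases : ε / 2 ≤ |(x : ℂ).re - (y : ℂ).re| ∨ ε / 2 ≤ |(x : ℂ).im - (y : ℂ).im| := by
    by_contra! h
    linarith [h.1, h.2]
  simp only [Finite.mem_toFinset, mem_iUnion]
  rcases hcases with h | h
  · obtain ⟨j, hj, z, hz, hzu⟩ := hC.exists_eq_mul_of_le_sub
      (Complex.continuous_re.comp continuous_subtype_val) hre (half_pos hε) hx hy h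
    exact ⟨z, ⟨j, hj, Or.inl hzu⟩, hz⟩
  · obtain ⟨j, hj, z, hz, hzu⟩ := hC.exists_eq_mul_of_le_sub
      (Complex.continuous_im.comp continuous_subtype_val) him (half_pos hε) hx hy h
    exact ⟨z, ⟨j, hj, Or.inr hzu⟩, hz⟩

theorem Circle.exists_preconnected_dist_lt {c : ℝ} (hc : 0 < c) :
    ∃ δ > 0, ∀ x y : Circle, dist x y < δ → ∃ C : Set Circle, IsPreconnected C ∧ x ∈ C ∧
      y ∈ C ∧ ∀ z ∈ C, ∀ w ∈ C, dist z w < c := by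
  obtain ⟨r, hr, hrc⟩ := Metric.continuousAt_iff.1 (Circle.exp.continuous.continuousAt (x := 0))
    (c / 2) (half_pos hc)
  -- A short arc around `1` is a neighbourhood of `1`; rotating it by `x` is isometric.
  have hnhds : Circle.exp '' Metric.ball 0 r ∈ 𝓝 (1 : Circle) := by
    rw [← Circle.exp_zero, ← isLocalHomeomorph_circleExp.map_nhds_eq 0]
    exact image_mem_map (Metric.ball_mem_nhds 0 hr)
  obtain ⟨δ, hδ, hsub⟩ := Metric.mem_nhds_iff.1 hnhds
  have hdist : ∀ x y z : Circle, dist (x * y) (x * z) = dist y z := by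
    intro x y z
    change dist ((x * y : Circle) : ℂ) ((x * z : Circle) : ℂ) = dist (y : ℂ) (z : ℂ)
    rw [Circle.coe_mul, Circle.coe_mul, Complex.dist_eq, ← mul_sub, norm_mul, Circle.norm_coe,
      one_mul, Complex.dist_eq]
  refine ⟨δ, hδ, fun x y hxy => ⟨(fun z => x * z) '' (Circle.exp '' Metric.ball 0 r), ?_, ?_, ?_,
    ?_⟩⟩
  · exact (((convex_ball (0 : ℝ) r).isPreconnected).image _ Circle.exp.continuous.continuousOn).image
      _ (continuous_const_mul x).continuousOn
  · exact ⟨1, ⟨0, Metric.mem_ball_self hr, Circle.exp_zero⟩, mul_one x⟩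
  · refine ⟨x⁻¹ * y, hsub ?_, mul_inv_cancel_left x y⟩
    rw [Metric.mem_ball, ← hdist x, mul_inv_cancel_left, mul_one, dist_comm]
    exact hxy
  · rintro _ ⟨_, ⟨s, hs, rfl⟩, rfl⟩ _ ⟨_, ⟨t, ht, rfl⟩, rfl⟩
    simp only [hdist]
    have h1 := hrc hs
    have h2 := hrc ht
    exact (dist_triangle_right _ _ _).trans_lt (by linarith)

/-! ### Absence of periodic points and sparse separation times -/

/-- A periodic point lifts to `F^k x = x + m`, making the translation number `m / k`. -/
theorem IsDenjoyCounterexample.iterate_ne {f : Circle ≃ₜ Circle} (hf : IsDenjoyCounterexample f)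
    {k : ℕ} (hk : 0 < k) (z : Circle) : f^[k] z ≠ z := by
  obtain ⟨F, hF, hirr, -⟩ := hf
  intro hz
  obtain ⟨t, rfl⟩ := Circle.exp_surjective z
  have h2π : 2 * Real.pi ≠ 0 := by positivity
  obtain ⟨x, rfl⟩ : ∃ x, t = 2 * Real.pi * x := ⟨t / (2 * Real.pi), by field_simp⟩
  have hit : ∀ n : ℕ, Circle.exp (2 * Real.pi * (F ^ n) x) =
      f^[n] (Circle.exp (2 * Real.pi * x)) := by
    intro n
    induction n with
    | zero => simp
    | succ n ih => rw [pow_succ', CircleDeg1Lift.mul_apply, hF, ih, Function.iterate_succ_apply']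
  rw [← hit, Circle.exp_eq_exp] at hz
  obtain ⟨m, hm⟩ := hz
  have hm' : (F ^ k) x = x + m := by
    apply mul_left_cancel₀ h2π
    rw [hm]
    ring
  have := F.translationNumber_of_map_pow_eq_add_int hm' hk
  exact hirr ⟨(m : ℚ) / k, by rw [this]; push_cast; rfl⟩

theorem exists_pos_le_dist_iterate {X : Type*} [MetricSpace X] [CompactSpace X] {f : X → X}
    (hf : Continuous f) (hper : ∀ k, 0 < k → ∀ z, f^[k] z ≠ z) (M : ℕ) :
    ∃ c > 0, ∀ k, 0 < k → k < M → ∀ z, c ≤ dist (f^[k] z) z := by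
  induction M with
  | zero => exact ⟨1, one_pos, fun k _ hk => absurd hk (Nat.not_lt_zero k)⟩
  | succ M ih =>
    obtain ⟨c, hc, h⟩ := ih
    have hM : ∃ c' > 0, 0 < M → ∀ z, c' ≤ dist (f^[M] z) z := by
      rcases Nat.eq_zero_or_pos M with rfl | hM
      · exact ⟨1, one_pos, fun h => absurd h (lt_irrefl 0)⟩
      obtain ⟨c', hc', h'⟩ := isCompact_univ.exists_forall_le' (a := 0)
        ((hf.iterate M).dist continuous_id).continuousOn
        (fun z _ => dist_pos.2 (hper M hM z))
      exact ⟨c', hc', fun _ z => h' z (mem_univ z)⟩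
    obtain ⟨c', hc', h'⟩ := hM
    refine ⟨min c c', lt_min hc hc', fun k hk hkM z => ?_⟩
    rcases Nat.lt_succ_iff_lt_or_eq.1 hkM with hlt | rfl
    · exact (min_le_left _ _).trans (h k hk hlt z)
    · exact (min_le_right _ _).trans (h' hk z)

/-- Without periodic points, two nearby points of the circle are `ε`-apart only at a sparse set
of times: every point of a fixed finite set is visited at most once in any `M` consecutive steps
by the iterates of a short arc joining the two points. -/
theorem exists_ncard_dist_iterate_le (f : Circle ≃ₜ Circle)
    (hper : ∀ k, 0 < k → ∀ z, f^[k] z ≠ z) {ε : ℝ} (hε : 0 < ε) :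
    ∃ q : ℕ, ∀ M : ℕ, 0 < M → ∃ δ > 0, ∀ x y : Circle, dist x y < δ → ∀ N : ℕ,
      ({n | ε ≤ dist (f^[n] x) (f^[n] y)} ∩ Iic N).ncard ≤ q * (N / M + 1) := by
  obtain ⟨P, hP⟩ := Circle.exists_finset_inter_preconnected hε
  refine ⟨P.card, fun M hM => ?_⟩
  obtain ⟨c, hc, hcM⟩ := exists_pos_le_dist_iterate f.continuous hper M
  obtain ⟨δ, hδ, hconn⟩ := Circle.exists_preconnected_dist_lt hc
  refine ⟨δ, hδ, fun x y hxy => ?_⟩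
  obtain ⟨C, hC, hx, hy, hdiam⟩ := hconn x y hxy
  have hvisit : ∀ n ∈ {n | ε ≤ dist (f^[n] x) (f^[n] y)}, ∃ p ∈ P, p ∈ f^[n] '' C := fun n hn =>
    hP _ (hC.image _ (f.continuous.iterate n).continuousOn) _ (mem_image_of_mem _ hx) _
      (mem_image_of_mem _ hy) hn
  choose! φ hφP hφC using hvisit
  refine ncard_inter_Iic_le_of_separated _ P φ hM hφP fun n hn m hm hlt h => ?_
  by_contra! hlt'
  obtain ⟨z, hz, hzn⟩ := hφC n hn
  obtain ⟨w, hw, hwm⟩ := hφC m hm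
  have hzw : f^[m - n] w = z := by
    apply f.injective.iterate n
    rw [← Function.iterate_add_apply, Nat.add_sub_cancel' hlt.le, hwm, hzn, h]
  have h1 := hcM (m - n) (by omega) (by omega) w
  rw [hzw] at h1
  exact absurd (hdiam z hz w hw) (not_lt.2 h1)

/-! ### Gaps of the minimal set and failure of equicontinuity -/

/-- A complementary arc of a closed subset of the circle, with its two endpoints. -/
theorem Circle.exists_complementary_arc {Λ : Set Circle} (hcl : IsClosed Λ) (hne : Λ.Nonempty)
    (huniv : Λ ≠ univ) :
    ∃ (G : Set Circle) (a b : Circle), IsOpen G ∧ IsPreconnected G ∧ Disjoint G Λ ∧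
      a ∈ Λ ∧ b ∈ Λ ∧ a ∈ closure G ∧ b ∈ closure G ∧ closure G ⊆ G ∪ {a, b} ∧
      (a = b → Λ = {a}) := by
  obtain ⟨w, hw⟩ := (ne_univ_iff_exists_notMem Λ).1 huniv
  obtain ⟨t, rfl⟩ := Circle.exp_surjective w
  obtain ⟨v, hv⟩ := hne
  obtain ⟨s, rfl⟩ := Circle.exp_surjective v
  have h2π : (0 : ℝ) < 2 * Real.pi := by positivity
  set L : Set ℝ := Circle.exp ⁻¹' Λ
  have hL : IsClosed L := hcl.preimage Circle.exp.continuous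
  -- By periodicity the lifted set has points on both sides of `t`, so `a` and `b` below exist.
  obtain ⟨s₁, hs₁, he₁⟩ := Circle.periodic_exp.exists_mem_Ico h2π s (t - 2 * Real.pi)
  obtain ⟨s₂, hs₂, he₂⟩ := Circle.periodic_exp.exists_mem_Ico h2π s t
  have hs₁L : s₁ ∈ L := by rwa [mem_preimage, ← he₁]
  have hs₂L : s₂ ∈ L := by rwa [mem_preimage, ← he₂]
  have hbd₁ : BddAbove (L ∩ Iic t) := ⟨t, fun _ h => h.2⟩
  have hbd₂ : BddBelow (L ∩ Ici t) := ⟨t, fun _ h => h.2⟩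
  obtain ⟨haL, hat⟩ := (hL.inter isClosed_Iic).csSup_mem
    ⟨s₁, hs₁L, (hs₁.2.trans_eq (sub_add_cancel _ _)).le⟩ hbd₁
  obtain ⟨hbL, hbt⟩ := (hL.inter isClosed_Ici).csInf_mem ⟨s₂, hs₂L, hs₂.1⟩ hbd₂
  set a := sSup (L ∩ Iic t)
  set b := sInf (L ∩ Ici t)
  have hab : a < b := by
    refine lt_of_le_of_ne (le_trans hat hbt) fun h => hw ?_
    have : t = a := le_antisymm (by rw [h]; exact hbt) hat
    rw [this]
    exact haL
  have hgap : ∀ x ∈ Ioo a b, x ∉ L := by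
    intro x hx hxL
    rcases le_total x t with h | h
    · exact not_lt.2 (le_csSup hbd₁ ⟨hxL, h⟩) hx.1
    · exact not_lt.2 (csInf_le hbd₂ ⟨hxL, h⟩) hx.2
  have hcl' : Circle.exp '' Icc a b ⊆ closure (Circle.exp '' Ioo a b) := by
    rw [← closure_Ioo hab.ne]
    exact image_closure_subset_closure_image Circle.exp.continuous
  refine ⟨Circle.exp '' Ioo a b, Circle.exp a, Circle.exp b,
    isLocalHomeomorph_circleExp.isOpenMap _ isOpen_Ioo,
    isPreconnected_Ioo.image _ Circle.exp.continuous.continuousOn, ?_, haL, hbL,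
    hcl' ⟨a, left_mem_Icc.2 hab.le, rfl⟩, hcl' ⟨b, right_mem_Icc.2 hab.le, rfl⟩, ?_, ?_⟩
  · rw [Set.disjoint_left]
    rintro _ ⟨x, hx, rfl⟩ hxΛ
    exact hgap x hx hxΛ
  · refine (closure_minimal (image_mono Ioo_subset_Icc_self)
      (isCompact_Icc.image Circle.exp.continuous).isClosed).trans ?_
    rintro _ ⟨x, hx, rfl⟩
    rcases eq_endpoints_or_mem_Ioo_of_mem_Icc hx with rfl | rfl | h
    · exact Or.inr (Or.inl rfl)
    · exact Or.inr (Or.inr rfl)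
    · exact Or.inl ⟨x, h, rfl⟩
  · intro heq
    -- If the endpoints coincide, the gap spans a full period and misses only one point.
    obtain ⟨m, hm⟩ := Circle.exp_eq_exp.1 heq.symm
    have hm1 : (1 : ℝ) ≤ m := by
      have : 0 < m := by
        by_contra! h
        have : (m : ℝ) ≤ 0 := by exact_mod_cast h
        nlinarith
      exact_mod_cast this
    refine eq_singleton_iff_unique_mem.2 ⟨haL, fun z hz => ?_⟩
    obtain ⟨r, rfl⟩ := Circle.exp_surjective z
    obtain ⟨x, hx, hxr⟩ := Circle.periodic_exp.exists_mem_Ico h2π r a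
    rw [hxr] at hz ⊢
    rcases eq_or_lt_of_le hx.1 with h | h
    · rw [h]
    · exact absurd hz (hgap x ⟨h, by nlinarith [hx.2]⟩)

/-- The compact set `f '' Λ` contains the forward orbit of `f x`, which is dense in `Λ`. -/
theorem IsMinimalCantorSet.image_eq {f : Circle → Circle} (hf : Continuous f) {Λ : Set Circle}
    (hΛ : IsMinimalCantorSet f Λ) : f '' Λ = Λ := by
  refine hΛ.mapsTo.image_subset.antisymm ?_
  obtain ⟨x, hx⟩ := hΛ.nonempty
  refine (hΛ.minimal _ (hΛ.mapsTo hx)).symm.subset.trans ?_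
  refine closure_minimal ?_ (hΛ.perfect.closed.isCompact.image hf).isClosed
  rintro _ ⟨n, rfl⟩
  refine ⟨f^[n] x, hΛ.mapsTo.iterate n hx, ?_⟩
  exact (Function.iterate_succ_apply' f n x).symm.trans (Function.iterate_succ_apply f n x)

/-- An open connected set `G` in the complement of an invariant set, with at most two boundary
points, both in the invariant set, is wandering for a homeomorphism without periodic points. -/
theorem disjoint_image_iterate_of_closure_subset {X : Type*} [TopologicalSpace X] (f : X ≃ₜ X)
    (hper : ∀ k, 0 < k → ∀ z, f^[k] z ≠ z) {Λ G : Set X} (hΛ : f '' Λ = Λ) {a b : X}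
    (hGo : IsOpen G) (hGc : IsPreconnected G) (hGΛ : Disjoint G Λ) (ha : a ∈ Λ) (hb : b ∈ Λ)
    (haG : a ∈ closure G) (hbG : b ∈ closure G) (hcl : closure G ⊆ G ∪ {a, b}) {k : ℕ}
    (hk : 0 < k) : Disjoint (f^[k] '' G) G := by
  have hΛk : ∀ n, f^[n] '' Λ = Λ := by
    intro n
    induction n with
    | zero => simp
    | succ n ih => rw [Function.iterate_succ, image_comp, hΛ, ih]
  have hinj : Function.Injective f^[k] := f.injective.iterate k
  have hcont : Continuous f^[k] := f.continuous.iterate k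
  have hdisj : Disjoint (f^[k] '' G) Λ := by
    rw [← hΛk k]
    exact (disjoint_image_iff hinj).2 hGΛ
  by_contra hmeet
  rw [Set.not_disjoint_iff_nonempty_inter] at hmeet
  -- A connected set meeting `G` and avoiding its boundary stays in `G`.
  have hsub : f^[k] '' G ⊆ G := by
    refine (hGc.image _ hcont.continuousOn).subset_of_closure_inter_subset hGo hmeet ?_
    rintro z ⟨hz, hzG⟩
    rcases hcl hz with h | rfl | rfl
    · exact h
    · exact absurd ha (Set.disjoint_left.1 hdisj hzG)
    · exact absurd hb (Set.disjoint_left.1 hdisj hzG)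
  have hend : ∀ z ∈ Λ, z ∈ closure G → f^[k] z = a ∨ f^[k] z = b := by
    intro z hz hzG
    have h1 : f^[k] z ∈ closure G :=
      closure_mono hsub (image_closure_subset_closure_image hcont (mem_image_of_mem _ hzG))
    have h2 : f^[k] z ∈ Λ := hΛk k ▸ mem_image_of_mem _ hz
    rcases hcl h1 with h | h
    · exact absurd h2 (Set.disjoint_left.1 hGΛ h)
    · exact h
  -- Neither endpoint is fixed, so they are swapped and `f^(2k)` fixes `a`.
  have hab : f^[k] a = b := (hend a ha haG).resolve_left (hper k hk a)
  have hba : f^[k] b = a := (hend b hb hbG).resolve_right (hper k hk b)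
  exact hper (k + k) (by omega) a (by rw [Function.iterate_add_apply, hab, hba])

/-- The preimages under iterates of a connected wandering set become small. -/
theorem Circle.exists_iterate_symm_dist_lt (f : Circle ≃ₜ Circle) {G : Set Circle}
    (hGc : IsPreconnected G) (hwand : ∀ k, 0 < k → Disjoint (f^[k] '' G) G) {a b : Circle}
    (ha : a ∈ closure G) (hb : b ∈ closure G) {δ : ℝ} (hδ : 0 < δ) :
    ∃ n : ℕ, dist (f.symm^[n] a) (f.symm^[n] b) < δ := by
  by_contra! hfar
  obtain ⟨P, hP⟩ := Circle.exists_finset_inter_preconnected (half_pos hδ)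
  have hvisit : ∀ n : ℕ, ∃ p ∈ P, p ∈ f.symm^[n] '' G := by
    intro n
    have hcont : Continuous f.symm^[n] := f.symm.continuous.iterate n
    -- The endpoints are only limits of `G`; two errors of `δ / 4` leave a distance of `δ / 2`.
    have hmem : ∀ z ∈ closure G, ∃ w ∈ f.symm^[n] '' G, dist (f.symm^[n] z) w < δ / 4 :=
      fun z hz => Metric.mem_closure_iff.1
        (image_closure_subset_closure_image hcont (mem_image_of_mem _ hz)) _ (by positivity)
    obtain ⟨x, hx, hax⟩ := hmem a ha
    obtain ⟨y, hy, hby⟩ := hmem b hb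
    refine hP _ (hGc.image _ hcont.continuousOn) x hx y hy ?_
    have h1 := dist_triangle4 (f.symm^[n] a) x y (f.symm^[n] b)
    rw [dist_comm y] at h1
    linarith [hfar n]
  choose φ hφP hφG using hvisit
  -- Pigeonhole: two preimages of `G` share a point of `P`, contradicting wandering.
  obtain ⟨n, m, hnm, h⟩ := Finite.exists_ne_map_eq_of_infinite fun n => (⟨φ n, hφP n⟩ : P)
  wlog hlt : n < m generalizing n m
  · exact this m n hnm.symm h.symm (by omega)
  obtain ⟨x, hx, hxn⟩ := hφG n
  obtain ⟨y, hy, hym⟩ := hφG m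
  have hxy : f.symm^[n] x = f.symm^[m] y := by
    rw [hxn, hym]
    exact congrArg Subtype.val h
  have hx' : f.symm^[m - n] y = x := by
    apply f.symm.injective.iterate n
    rw [← Function.iterate_add_apply, Nat.add_sub_cancel' hlt.le, hxy]
  have hy' : f^[m - n] x = y := by
    rw [← hx']
    exact (Function.LeftInverse.iterate f.apply_symm_apply (m - n)) y
  exact Set.disjoint_left.1 (hwand (m - n) (by omega)) ⟨x, hx, hy'⟩ hy

theorem IsMinimalCantorSet.not_uniformEquicontinuous {f : Circle ≃ₜ Circle}
    (hper : ∀ k, 0 < k → ∀ z, f^[k] z ≠ z) {Λ : Set Circle} (hΛ : IsMinimalCantorSet f Λ) :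
    ¬ UniformEquicontinuous (fun n : ℕ => (hΛ.mapsTo.restrict f Λ Λ)^[n]) := by
  have himg := hΛ.image_eq f.continuous
  have huniv : Λ ≠ univ := by
    rintro rfl
    have hsub := hΛ.totallyDisconnected _ (subset_univ (range Circle.exp))
      (isPreconnected_range Circle.exp.continuous)
    exact Circle.exp_pi_ne_one
      (hsub (mem_range_self _) ⟨0, Circle.exp_zero⟩)
  obtain ⟨G, a, b, hGo, hGc, hGΛ, ha, hb, haG, hbG, hcl, hab⟩ :=
    Circle.exists_complementary_arc hΛ.perfect.closed hΛ.nonempty huniv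
  have hne : a ≠ b := by
    intro h
    have h1 : f a ∈ Λ := hΛ.mapsTo ha
    rw [hab h] at h1
    exact hper 1 one_pos a h1
  intro hequi
  obtain ⟨δ, hδ, h⟩ := Metric.uniformEquicontinuous_iff.1 hequi _ (dist_pos.2 hne)
  obtain ⟨n, hn⟩ := Circle.exists_iterate_symm_dist_lt f hGc
    (fun k hk => disjoint_image_iterate_of_closure_subset f hper himg hGo hGc hGΛ ha hb haG hbG
      hcl hk) haG hbG hδ
  have hsymm : MapsTo f.symm Λ Λ := by
    intro z hz
    rw [← himg] at hz
    obtain ⟨w, hw, rfl⟩ := hz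
    rwa [f.symm_apply_apply]
  have key := h ⟨_, hsymm.iterate n ha⟩ ⟨_, hsymm.iterate n hb⟩ hn n
  rw [hΛ.mapsTo.iterate_restrict] at key
  have hinv : ∀ z, f^[n] (f.symm^[n] z) = z :=
    Function.LeftInverse.iterate f.apply_symm_apply n
  rw [Subtype.dist_eq, MapsTo.val_restrict_apply, MapsTo.val_restrict_apply, hinv, hinv] at key
  exact lt_irrefl _ key

theorem IsMinimalCantorSet.isMeanLyapunovStableAlong {f : Circle ≃ₜ Circle}
    (hper : ∀ k, 0 < k → ∀ z, f^[k] z ≠ z) {Λ : Set Circle} (hΛ : IsMinimalCantorSet f Λ)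
    {a : ℕ → ℕ} (ha : StrictMonoOn a (Ici 1)) (hd : 0 < lowerDensity (a '' Ici 1)) :
    IsMeanLyapunovStableAlong a (hΛ.mapsTo.restrict f Λ Λ) := by
  intro ε hε
  obtain ⟨c, hc, hac⟩ := exists_mul_le_of_lowerDensity_pos ha hd
  obtain ⟨q, hq⟩ := exists_ncard_dist_iterate_le f hper hε
  -- This `M` makes the density bound `q / (c * M)` less than `ε / 4`.
  obtain ⟨M, hM⟩ := exists_nat_gt (4 * q / (ε * c))
  have hM0 : 0 < M := by
    have : (0 : ℝ) < M := lt_of_le_of_lt (by positivity) hM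
    exact_mod_cast this
  obtain ⟨δ, hδ, h⟩ := hq M hM0
  refine ⟨δ, hδ, fun x y hxy => ⟨{n | ε ≤ dist (f^[n] x) (f^[n] y)},
    upperDensityAlong_lt_of_ncard_le ha hε hac hM0 ?_ (h x y hxy), fun n _ hn => ?_⟩⟩
  · rw [div_lt_iff₀ (by positivity)] at hM
    linarith
  · rw [hΛ.mapsTo.iterate_restrict]
    exact not_le.1 hn

theorem corollary3p6 (f : Circle ≃ₜ Circle) (hf : IsDenjoyCounterexample f)
    (Λ : Set Circle) (hΛ : IsMinimalCantorSet f Λ) :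
    (∀ a : ℕ → ℕ, StrictMonoOn a (Set.Ici 1) → 0 < lowerDensity (a '' Set.Ici 1) →
      IsMeanLyapunovStableAlong a (hΛ.mapsTo.restrict f Λ Λ)) ∧
    ¬ UniformEquicontinuous (fun n : ℕ => (hΛ.mapsTo.restrict f Λ Λ)^[n]) := by
  have hper : ∀ k, 0 < k → ∀ z, f^[k] z ≠ z := fun _ hk z => hf.iterate_ne hk z
  exact ⟨fun _ ha hd => hΛ.isMeanLyapunovStableAlong hper ha hd, hΛ.not_uniformEquicontinuous hper⟩
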